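/- Let $L$ be an algebraic language (operation symbols of finite arity) with a constant symbol $1$, and let $\mathcal Q$ be a quasivariety of $L$-algebras, i.e. the class of all $L$-algebras satisfying some set of quasi-identities (implications from finitely many equations to one equation). A *$\mathcal Q$-congruence* of $A\in\mathcal Q$ is a congruence $\theta$ of $A$ with $A/\theta\in\mathcal Q$; its *kernel* is the class $[1]_\theta$. Suppose that $\mathcal Q$ is *relatively $1$-regular*: whenever $A\in\mathcal Q$ and $\varphi,\psi$ are $\mathcal Q$-congruences of $A$ with $[1]_\varphi=[1]_\psi$, then $\varphi=\psi$. An *ideal term* is a term $t(x_1,\dots,x_m,y_1,\dots,y_n)$ such that $\mathcal Q$ satisfies the identity $t(x_1,\dots,x_m,1,\dots,1)= 1$. An *ideal* of $A\in\mathcal Q$ is a non-empty subset $I\subseteq A$ such that $t(a_1,\dots,a_m,b_1,\dots,b_n)\in I$ for every ideal term $t$, all $a_1,\dots,a_m\in A$ and all $b_1,\dots,b_n\in I$. The quasivariety $\mathcal Q$ is *relatively ideal determined* if, for every $A\in\mathcal Q$, every ideal of $A$ is the kernel of a unique $\mathcal Q$-congruence of $A$. Then $\mathcal Q$ is relatively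 ideal determined if and only if both of the following hold: 1. $\mathcal Q$ is *$1$-conservative*: $\mathcal Q$ and the variety $\mathrm{HSP}(\mathcal Q)$ generated by $\mathcal Q$ satisfy the same quasi-identities of the form $$s_1(x_1,\dots,x_k)= 1\ \wedge\dots\wedge\ s_n(x_1,\dots,x_k)= 1\ \Rightarrow\ t(x_1,\dots,x_k)= 1 ;$$ 2. $\mathcal Q$ has a *subtractive term*: there is a binary term $s(x,y)$ such that $\mathcal Q$ satisfies the identities $s(x,x)= 1$ and $s(x,1)= x$. -/

import Mathlib

open FirstOrder CategoryTheory

universe u v w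

namespace UnivAlg

open FirstOrder.Language FirstOrder.Language.Structure

/-- A class of algebras of the language `L`. (The language is assumed to have only function symbols
wherever this is used for algebras; all arities are finite.) -/
abbrev AlgClass (L : FirstOrder.Language.{u, v}) := Set (Bundled.{w} L.Structure)

/-- An equation `lhs ≈ rhs` between terms in countably many variables. -/
structure Equation (L : FirstOrder.Language.{u, v}) where
  lhs : L.Term ℕ
  rhs : L.Term ℕ

/-- The equation `e` holds in `A` under the assignment `x`. -/
def Equation.HoldsAt {L : FirstOrder.Language.{u, v}} (e : Equation L)
    {A : Type w} [L.Structure A] (x : ℕ → A) : Prop :=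
  e.lhs.realize x = e.rhs.realize x

/-- A quasi-identity: finitely many (possibly no) equations implying one equation. -/
structure QuasiIdentity (L : FirstOrder.Language.{u, v}) where
  premises : List (Equation L)
  conclusion : Equation L

/-- The algebra `A` satisfies the quasi-identity `q`. -/
def QuasiIdentity.HoldsIn {L : FirstOrder.Language.{u, v}} (q : QuasiIdentity L)
    (A : Type w) [L.Structure A] : Prop :=
  ∀ x : ℕ → A, (∀ e ∈ q.premises, e.HoldsAt x) → q.conclusion.HoldsAt x

/-- The class `K` satisfies the quasi-identity `q`, i.e. all its members do. -/
def AlgClass.Satisfies {L : FirstOrder.Language.{u, v}} (K : AlgClass.{u, v, w} L)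
    (q : QuasiIdentity L) : Prop :=
  ∀ A ∈ K, q.HoldsIn A

/-- A quasivariety: the class of all algebras satisfying some set of quasi-identities. -/
def IsQuasivariety {L : FirstOrder.Language.{u, v}} (K : AlgClass.{u, v, w} L) : Prop :=
  ∃ Γ : Set (QuasiIdentity L), ∀ A : Bundled.{w} L.Structure, A ∈ K ↔ ∀ q ∈ Γ, q.HoldsIn A

/-- The direct product of a family of structures. -/
instance piStructure {L : FirstOrder.Language.{u, v}} {I : Type w} (B : I → Type w)
    [∀ i, L.Structure (B i)] : L.Structure (∀ i, B i) where
  funMap f x := fun i => funMap f fun j => x j i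
  RelMap r x := ∀ i, RelMap r fun j => x j i

/-- All homomorphic images of members of `K`. -/
def opH {L : FirstOrder.Language.{u, v}} (K : AlgClass.{u, v, w} L) : AlgClass.{u, v, w} L :=
  {A | ∃ B ∈ K, ∃ h : B →[L] A, Function.Surjective h}

/-- All algebras isomorphic to subalgebras of members of `K`. -/
def opS {L : FirstOrder.Language.{u, v}} (K : AlgClass.{u, v, w} L) : AlgClass.{u, v, w} L :=
  {A | ∃ B ∈ K, ∃ S : L.Substructure B, Nonempty (A ≃[L] S)}

/-- All algebras isomorphic to direct products of (set-indexed) families of members of `K`. -/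
def opP {L : FirstOrder.Language.{u, v}} (K : AlgClass.{u, v, w} L) : AlgClass.{u, v, w} L :=
  {A | ∃ (I : Type w) (B : I → Bundled.{w} L.Structure),
    (∀ i, B i ∈ K) ∧ Nonempty (A ≃[L] (∀ i, B i))}

/-- The variety `HSP(K)` generated by `K`. -/
def HSP {L : FirstOrder.Language.{u, v}} (K : AlgClass.{u, v, w} L) : AlgClass.{u, v, w} L :=
  opH (opS (opP K))

/-- A congruence of `A`: an equivalence relation compatible with all operations. -/
@[ext]
structure Congruence (L : FirstOrder.Language.{u, v}) (A : Type w) [L.Structure A]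
    extends Setoid A where
  compat : ∀ {n : ℕ} (f : L.Functions n) (x y : Fin n → A),
    (∀ i, r (x i) (y i)) → r (funMap f x) (funMap f y)

/-- The operations of `A` pass to the quotient by a congruence. -/
abbrev Congruence.prestructure {L : FirstOrder.Language.{u, v}} [L.IsAlgebraic]
    {A : Type w} [str : L.Structure A] (θ : Congruence L A) : L.Prestructure θ.toSetoid where
  toStructure := str
  fun_equiv {_} {f} x y h := θ.compat f x y h
  rel_equiv {_} {r} _ _ _ := (IsEmpty.false r).elim

/-- The quotient algebra `A / θ`. -/
def Congruence.quotientAlg {L : FirstOrder.Language.{u, v}} [L.IsAlgebraic]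
    {A : Type w} [L.Structure A] (θ : Congruence L A) : Bundled.{w} L.Structure :=
  ⟨Quotient θ.toSetoid, @FirstOrder.Language.quotientStructure L A θ.toSetoid θ.prestructure⟩

/-- `θ` is a `K`-congruence of `A`: the quotient `A / θ` belongs to `K`. -/
def Congruence.IsRelative {L : FirstOrder.Language.{u, v}} [L.IsAlgebraic]
    (K : AlgClass.{u, v, w} L) {A : Type w} [L.Structure A] (θ : Congruence L A) : Prop :=
  θ.quotientAlg ∈ K

/-- The kernel `[1]_θ`, where `1` is the interpretation of the constant symbol `c`. -/
def Congruence.kernel {L : FirstOrder.Language.{u, v}} (c : L.Constants)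
    {A : Type w} [L.Structure A] (θ : Congruence L A) : Set A :=
  {a | θ.r a (c : A)}

/-- `K` is relatively `1`-regular: relative congruences of members of `K` are determined by their
kernels. -/
def RelativelyRegular {L : FirstOrder.Language.{u, v}} [L.IsAlgebraic] (c : L.Constants)
    (K : AlgClass.{u, v, w} L) : Prop :=
  ∀ A ∈ K, ∀ φ ψ : Congruence L A, φ.IsRelative K → ψ.IsRelative K →
    φ.kernel c = ψ.kernel c → φ = ψ

/-- `t(x₁,…,xₘ,y₁,…,yₙ)` is a `K`-ideal term in `y₁,…,yₙ`: `K` satisfies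
`t(x₁,…,xₘ,1,…,1) ≈ 1`. -/
def IsIdealTerm {L : FirstOrder.Language.{u, v}} (c : L.Constants) (K : AlgClass.{u, v, w} L)
    {m n : ℕ} (t : L.Term (Fin m ⊕ Fin n)) : Prop :=
  ∀ A ∈ K, ∀ a : Fin m → A, t.realize (Sum.elim a fun _ => (c : A)) = (c : A)

/-- `I` is a `K`-ideal of `A`: non-empty and closed under all `K`-ideal terms. -/
def IsIdeal {L : FirstOrder.Language.{u, v}} (c : L.Constants) (K : AlgClass.{u, v, w} L)
    {A : Type w} [L.Structure A] (I : Set A) : Prop :=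
  I.Nonempty ∧ ∀ (m n : ℕ) (t : L.Term (Fin m ⊕ Fin n)), IsIdealTerm c K t →
    ∀ (a : Fin m → A) (b : Fin n → A), (∀ j, b j ∈ I) → t.realize (Sum.elim a b) ∈ I

/-- `K` is relatively ideal determined: every `K`-ideal of every member of `K` is the kernel of
exactly one `K`-congruence. -/
def RelativelyIdealDetermined {L : FirstOrder.Language.{u, v}} [L.IsAlgebraic] (c : L.Constants)
    (K : AlgClass.{u, v, w} L) : Prop :=
  ∀ A ∈ K, ∀ I : Set A, IsIdeal c K I →
    ∃! θ : Congruence L A, θ.IsRelative K ∧ θ.kernel c = I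

/-- The quasi-identity `s₁ ≈ 1 ∧ … ∧ sₙ ≈ 1 ⇒ t ≈ 1`. -/
def oneQuasiIdentity {L : FirstOrder.Language.{u, v}} (c : L.Constants)
    (s : List (L.Term ℕ)) (t : L.Term ℕ) : QuasiIdentity L where
  premises := s.map fun p => ⟨p, c.term⟩
  conclusion := ⟨t, c.term⟩

/-- `K` is `1`-conservative: `K` and `HSP(K)` satisfy the same quasi-identities of the form
`s₁ ≈ 1 ∧ … ∧ sₙ ≈ 1 ⇒ t ≈ 1`. -/
def OneConservative {L : FirstOrder.Language.{u, v}} (c : L.Constants)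
    (K : AlgClass.{u, v, w} L) : Prop :=
  ∀ (s : List (L.Term ℕ)) (t : L.Term ℕ),
    K.Satisfies (oneQuasiIdentity c s t) ↔ AlgClass.Satisfies (HSP K) (oneQuasiIdentity c s t)

/-- The binary term `s(x,y)` is a subtractive term for `K`: `K` satisfies `s(x,x) ≈ 1` and
`s(x,1) ≈ x`. -/
def IsSubtractiveTerm {L : FirstOrder.Language.{u, v}} (c : L.Constants)
    (K : AlgClass.{u, v, w} L) (s : L.Term (Fin 2)) : Prop :=
  ∀ A ∈ K, ∀ a : A, s.realize ![a, a] = (c : A) ∧ s.realize ![a, (c : A)] = a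

end UnivAlg

namespace UnivAlg

open FirstOrder.Language FirstOrder.Language.Structure

/-! ### Congruences, quotients and kernels -/

section Congruences

variable {L : FirstOrder.Language.{u, v}}

/-! Necessity of 1-conservativity: if `g` maps `A ∈ K` onto `B`, then the preimage of 1 is an ideal,
hence the kernel of a `K`-congruence `θ`. The same terms take the value 1 in `A/θ ∈ K` and in `B`,
so implications between equations `s ≈ 1` pass from `K` to `B`. The subtractive term comes from the
free algebra on x, y (`exists_isSubtractiveTerm`).

Sufficiency: a subtractive term makes each ideal `I` the kernel of some congruence `φ`
(`kernel_polyCongruence`), but `A/φ` is only known to lie in `HSP K`. Relative regularity yields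
finitely many difference terms (`exists_differenceTerms`), which encode every equality in `A` by
equations `s ≈ 1`. Consequences in `K` of finitely many equations `s ≈ 1` with `s` valued in `I`
therefore define a `K`-congruence `θ` whose kernel contains `I`. Conservativity (`realize_eq`)
transfers each consequence of the form `t ≈ 1` to `A/φ`, so the kernel of `θ` is no larger than `I`.
Uniqueness is regularity. -/

theorem realize_hom {A B X : Type*} [L.Structure A] [L.Structure B] (h : A →[L] B)
    (t : L.Term X) (x : X → A) : t.realize (fun i => h (x i)) = h (t.realize x) :=
  HomClass.realize_term (v := x) h

/-- The kernel of a homomorphism, as a congruence. -/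
def homKer {A B : Type*} [L.Structure A] [L.Structure B] (h : A →[L] B) : Congruence L A where
  r a b := h a = h b
  iseqv := ⟨fun _ => rfl, fun e => e.symm, fun e e' => e.trans e'⟩
  compat f x y e := by
    rw [HomClass.map_fun, HomClass.map_fun]
    exact congrArg _ (funext e)

/-- The projection onto a quotient algebra. -/
def Congruence.proj [L.IsAlgebraic] {A : Type w} [L.Structure A] (θ : Congruence L A) :
    A →[L] θ.quotientAlg where
  toFun a := (Quotient.mk θ.toSetoid a : Quotient θ.toSetoid)
  map_fun' f x :=
    (@FirstOrder.Language.funMap_quotient_mk' L A θ.toSetoid θ.prestructure _ f x).symm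
  map_rel' r := (IsEmpty.false r).elim

theorem Congruence.proj_surjective [L.IsAlgebraic]
    {A : Type w} [L.Structure A] (θ : Congruence L A) :
    Function.Surjective θ.proj :=
  Quotient.mk_surjective

theorem Congruence.proj_eq_iff [L.IsAlgebraic]
    {A : Type w} [L.Structure A] (θ : Congruence L A) {a b : A} :
    θ.proj a = θ.proj b ↔ θ.r a b :=
  Quotient.eq (r := θ.toSetoid)

theorem Congruence.mem_kernel_iff [L.IsAlgebraic] (c : L.Constants) {A : Type w} [L.Structure A]
    (θ : Congruence L A) {a : A} : a ∈ θ.kernel c ↔ θ.proj a = (c : θ.quotientAlg) := by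
  rw [← Hom.map_constants θ.proj c, θ.proj_eq_iff]
  rfl

/-- A quasi-identity, read modulo a relation. -/
def QuasiIdentity.HoldsMod {A : Type*} [L.Structure A] (q : QuasiIdentity L)
    (r : A → A → Prop) : Prop :=
  ∀ x : ℕ → A, (∀ e ∈ q.premises, r (e.lhs.realize x) (e.rhs.realize x)) →
    r (q.conclusion.lhs.realize x) (q.conclusion.rhs.realize x)

theorem Congruence.holdsIn_quotientAlg_iff [L.IsAlgebraic]
    {A : Type w} [L.Structure A] (θ : Congruence L A)
    (q : QuasiIdentity L) : q.HoldsIn θ.quotientAlg ↔ q.HoldsMod θ.r := by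
  have key (e : Equation L) (x : ℕ → A) :
      e.HoldsAt (fun i => θ.proj (x i)) ↔ θ.r (e.lhs.realize x) (e.rhs.realize x) := by
    rw [Equation.HoldsAt, realize_hom, realize_hom, θ.proj_eq_iff]
  constructor
  · intro h x hx
    exact (key _ x).1 (h _ fun e he => (key e x).2 (hx e he))
  · intro h y hy
    choose x hx using fun i => θ.proj_surjective (y i)
    obtain rfl : (fun i => θ.proj (x i)) = y := funext hx
    exact (key _ x).2 (h x fun e he => (key e x).1 (hy e he))

/-- `K` is axiomatized by the quasi-identities in `Γ`. -/
def AxiomatizedBy (K : AlgClass.{u, v, w} L) (Γ : Set (QuasiIdentity L)) : Prop :=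
  ∀ A : Bundled.{w} L.Structure, A ∈ K ↔ ∀ q ∈ Γ, q.HoldsIn A

theorem AxiomatizedBy.isRelative_iff [L.IsAlgebraic]
    {K : AlgClass.{u, v, w} L} {Γ : Set (QuasiIdentity L)}
    (hΓ : AxiomatizedBy K Γ) {A : Type w} [L.Structure A] (θ : Congruence L A) :
    θ.IsRelative K ↔ ∀ q ∈ Γ, q.HoldsMod θ.r := by
  simp only [Congruence.IsRelative, hΓ θ.quotientAlg, θ.holdsIn_quotientAlg_iff]

theorem AxiomatizedBy.holdsMod_homKer {K : AlgClass.{u, v, w} L} {Γ : Set (QuasiIdentity L)}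
    (hΓ : AxiomatizedBy K Γ) {A : Type*} [L.Structure A] {B : Bundled.{w} L.Structure}
    (hB : B ∈ K) (h : A →[L] B) {q : QuasiIdentity L} (hq : q ∈ Γ) :
    q.HoldsMod (homKer h).r := by
  intro x hx
  have key (e : Equation L) :
      e.HoldsAt (fun i => h (x i)) ↔ (homKer h).r (e.lhs.realize x) (e.rhs.realize x) := by
    rw [Equation.HoldsAt, realize_hom, realize_hom]
    rfl
  exact (key _).1 ((hΓ B).1 hB q hq _ fun e he => (key e).2 (hx e he))

/-- The intersection of the kernels of all homomorphisms into members of `K` with a given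
property. -/
def Congruence.ofHoms (K : AlgClass.{u, v, w} L) {A : Type w} [L.Structure A]
    (P : ∀ B : Bundled.{w} L.Structure, (A →[L] B) → Prop) : Congruence L A where
  r a b := ∀ B ∈ K, ∀ h : A →[L] B, P B h → h a = h b
  iseqv := ⟨fun _ _ _ _ _ => rfl, fun e B hB h hh => (e B hB h hh).symm,
    fun e e' B hB h hh => (e B hB h hh).trans (e' B hB h hh)⟩
  compat f x y e B hB h hh := (homKer h).compat f x y fun i => e i B hB h hh

/-- Quasi-identities modulo a relation survive arbitrary intersections. This supplies least
`K`-congruences without constructing products. -/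
theorem AxiomatizedBy.isRelative_ofHoms [L.IsAlgebraic]
    {K : AlgClass.{u, v, w} L} {Γ : Set (QuasiIdentity L)}
    (hΓ : AxiomatizedBy K Γ) {A : Type w} [L.Structure A]
    (P : ∀ B : Bundled.{w} L.Structure, (A →[L] B) → Prop) :
    (Congruence.ofHoms K P).IsRelative K := by
  rw [hΓ.isRelative_iff]
  intro q hq x hx B hB h hh
  exact hΓ.holdsMod_homKer hB h hq x fun e he => hx e he B hB h hh

/-- The intersection of two congruences. -/
def Congruence.inter {A : Type w} [L.Structure A] (φ ψ : Congruence L A) : Congruence L A where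
  r a b := φ.r a b ∧ ψ.r a b
  iseqv := ⟨fun a => ⟨φ.refl a, ψ.refl a⟩, fun e => ⟨φ.symm e.1, ψ.symm e.2⟩,
    fun e e' => ⟨φ.trans e.1 e'.1, ψ.trans e.2 e'.2⟩⟩
  compat f x y e := ⟨φ.compat f x y fun i => (e i).1, ψ.compat f x y fun i => (e i).2⟩

theorem AxiomatizedBy.isRelative_inter [L.IsAlgebraic]
    {K : AlgClass.{u, v, w} L} {Γ : Set (QuasiIdentity L)}
    (hΓ : AxiomatizedBy K Γ) {A : Type w} [L.Structure A] {φ ψ : Congruence L A}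
    (hφ : φ.IsRelative K) (hψ : ψ.IsRelative K) : (φ.inter ψ).IsRelative K := by
  rw [hΓ.isRelative_iff] at *
  exact fun q hq x hx =>
    ⟨hφ q hq x fun e he => (hx e he).1, hψ q hq x fun e he => (hx e he).2⟩

/-- The preimage of `1` under a homomorphism from a member of `K` is an ideal. -/
theorem isIdeal_preimage_const {c : L.Constants} {K : AlgClass.{u, v, w} L}
    {A : Bundled.{w} L.Structure} (hA : A ∈ K) {B : Type*} [L.Structure B] (h : A →[L] B) :
    IsIdeal c K {a : A | h a = (c : B)} := by
  refine ⟨⟨(c : A), Hom.map_constants h c⟩, fun m n t ht a b hb => ?_⟩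
  have e : (fun i => h (Sum.elim a b i)) = fun i => h (Sum.elim a (fun _ => (c : A)) i) := by
    funext i
    rcases i with i | i
    · rfl
    · exact (hb i).trans (Hom.map_constants h c).symm
  change h _ = _
  -- The identity is used only in `A`, so `B` need not belong to `K`.
  rw [← realize_hom, e, realize_hom, ht A hA a, Hom.map_constants]

theorem isIdeal_kernel [L.IsAlgebraic] {c : L.Constants} {K : AlgClass.{u, v, w} L}
    {A : Bundled.{w} L.Structure} (hA : A ∈ K) (θ : Congruence L A) :
    IsIdeal c K (θ.kernel c) := by
  have : θ.kernel c = {a : A | θ.proj a = (c : θ.quotientAlg)} :=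
    Set.ext fun a => θ.mem_kernel_iff c
  rw [this]
  exact isIdeal_preimage_const hA θ.proj

end Congruences

/-! ### Closure of a quasivariety under subalgebras and products -/

section ClassOperators

variable {L : FirstOrder.Language.{u, v}}

theorem mem_opS_self {K : AlgClass.{u, v, w} L} {A : Bundled.{w} L.Structure} (hA : A ∈ K) :
    A ∈ opS K :=
  ⟨A, hA, ⊤, ⟨Substructure.topEquiv.symm⟩⟩

theorem mem_opP_self [L.IsAlgebraic]
    {K : AlgClass.{u, v, w} L} {A : Bundled.{w} L.Structure} (hA : A ∈ K) :
    A ∈ opP K := by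
  refine ⟨PUnit, fun _ => A, fun _ => hA, ⟨⟨Equiv.ofBijective (fun a _ => a)
    ⟨fun a b e => congrFun e PUnit.unit, fun f => ⟨f PUnit.unit, rfl⟩⟩, fun f x => rfl,
    fun r => (IsEmpty.false r).elim⟩⟩⟩

theorem mem_HSP_of_surjective [L.IsAlgebraic]
    {K : AlgClass.{u, v, w} L} {A B : Bundled.{w} L.Structure}
    (hA : A ∈ K) (h : A →[L] B) (hh : Function.Surjective h) : B ∈ HSP K :=
  ⟨A, mem_opS_self (mem_opP_self hA), h, hh⟩

theorem mem_HSP_self [L.IsAlgebraic]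
    {K : AlgClass.{u, v, w} L} {A : Bundled.{w} L.Structure} (hA : A ∈ K) :
    A ∈ HSP K :=
  mem_HSP_of_surjective hA (Hom.id L A) Function.surjective_id

theorem QuasiIdentity.HoldsIn.of_injective_family {q : QuasiIdentity L} {A : Type*}
    [L.Structure A] {I : Type*} {B : I → Type*} [∀ i, L.Structure (B i)]
    (h : ∀ i, A →[L] B i) (hinj : ∀ a b, (∀ i, h i a = h i b) → a = b)
    (hq : ∀ i, q.HoldsIn (B i)) : q.HoldsIn A := by
  intro x hx
  refine hinj _ _ fun i => ?_
  rw [← realize_hom, ← realize_hom]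
  refine hq i _ fun e he => ?_
  rw [Equation.HoldsAt, realize_hom, realize_hom, hx e he]

theorem IsQuasivariety.mem_of_mem_opS_opP [L.IsAlgebraic]
    {K : AlgClass.{u, v, w} L} (hK : IsQuasivariety K)
    {A : Bundled.{w} L.Structure} (hA : A ∈ opS (opP K)) : A ∈ K := by
  obtain ⟨Γ, hΓ⟩ := hK
  obtain ⟨C, ⟨I, B, hB, ⟨g⟩⟩, S, ⟨k⟩⟩ := hA
  refine (hΓ A).2 fun q hq => ?_
  let π (i : I) : (∀ i, B i) →[L] B i := ⟨fun f => f i, fun _ _ => rfl, fun r =>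
    (IsEmpty.false r).elim⟩
  refine QuasiIdentity.HoldsIn.of_injective_family
    (fun i => (π i).comp (g.toHom.comp (S.subtype.toHom.comp k.toHom))) (fun a b e => ?_)
    fun i => (hΓ (B i)).1 (hB i) q hq
  have h1 : g (k a : C) = g (k b : C) := funext e
  exact k.injective (Subtype.ext (g.injective h1))

end ClassOperators

/-! ### Term algebras and free algebras -/

section FreeAlgebra

variable {L : FirstOrder.Language.{u, v}}

/-- The algebra of terms. -/
instance termStructure [L.IsAlgebraic] (X : Type*) : L.Structure (L.Term X) where
  funMap f x := FirstOrder.Language.Term.func f x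
  RelMap r _ := (IsEmpty.false r).elim

/-- Evaluation of terms, as a homomorphism. -/
def evalHom [L.IsAlgebraic] {X A : Type*} [L.Structure A] (x : X → A) : L.Term X →[L] A where
  toFun t := t.realize x
  map_fun' _ _ := rfl
  map_rel' r := (IsEmpty.false r).elim

theorem realize_var [L.IsAlgebraic] {X : Type*} (t : L.Term X) :
    t.realize (fun i => (FirstOrder.Language.Term.var i : L.Term X)) = t := by
  induction t with
  | var => rfl
  | func f ts ih =>
    rw [FirstOrder.Language.Term.realize_func]
    simp only [ih]
    rfl

/-- A quasivariety has free algebras. -/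
theorem AxiomatizedBy.exists_free [L.IsAlgebraic]
    {K : AlgClass.{u, v, max u w} L} {Γ : Set (QuasiIdentity L)}
    (hΓ : AxiomatizedBy K Γ) (X : Type (max u w)) :
    ∃ F ∈ K, ∃ g : X → F, (∀ a : F, ∃ t : L.Term X, t.realize g = a) ∧
      (∀ B ∈ K, ∀ x : X → B, ∃ h : F →[L] B, ∀ i, h (g i) = x i) := by
  let θ : Congruence L (L.Term X) := Congruence.ofHoms K fun _ _ => True
  refine ⟨θ.quotientAlg, hΓ.isRelative_ofHoms _,
    fun i => θ.proj (FirstOrder.Language.Term.var i), fun a => ?_, fun B hB x => ?_⟩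
  · obtain ⟨t, rfl⟩ := θ.proj_surjective a
    exact ⟨t, by rw [realize_hom, realize_var]⟩
  · have hx (p q : L.Term X) (e : θ.r p q) : evalHom x p = evalHom x q := e B hB _ trivial
    let h : θ.quotientAlg → B := Quotient.lift (s := θ.toSetoid) (evalHom x) hx
    have hp (t : L.Term X) : h (θ.proj t) = evalHom x t := rfl
    refine ⟨⟨h, fun f y => ?_, fun r => (IsEmpty.false r).elim⟩, fun i => rfl⟩
    choose z hz using fun i => θ.proj_surjective (y i)
    obtain rfl : (fun i => θ.proj (z i)) = y := funext hz
    have e : funMap f (fun i => θ.proj (z i)) = θ.proj (funMap f z) :=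
      (HomClass.map_fun θ.proj f z).symm
    rw [e, hp, HomClass.map_fun]
    rfl

end FreeAlgebra

/-! ### Consequences of relative ideal determinacy -/

section IdealDetermined

variable {L : FirstOrder.Language.{u, v}}

theorem RelativelyIdealDetermined.oneConservative [L.IsAlgebraic] {c : L.Constants}
    {K : AlgClass.{u, v, w} L} (hK : IsQuasivariety K)
    (h : RelativelyIdealDetermined c K) : OneConservative c K := by
  intro s t
  refine ⟨fun hst B hB x hx => ?_, fun hst A hA => hst A (mem_HSP_self hA)⟩
  obtain ⟨A, hA, g, hg⟩ := hB
  have hA := hK.mem_of_mem_opS_opP hA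
  obtain ⟨θ, ⟨hθ, hk⟩, -⟩ := h A hA _ (isIdeal_preimage_const (c := c) hA g)
  choose y hy using fun i => hg (x i)
  obtain rfl : (fun i => g (y i)) = x := funext hy
  have key (p : L.Term ℕ) :
      p.realize (fun i => θ.proj (y i)) = (c : θ.quotientAlg) ↔
        p.realize (fun i => g (y i)) = (c : B) := by
    rw [realize_hom, realize_hom, ← θ.mem_kernel_iff, hk]
    rfl
  have := hst _ hθ (fun i => θ.proj (y i)) (by
    intro e he
    obtain ⟨p, hp, rfl⟩ := List.mem_map.1 he
    have := hx _ he
    simp only [Equation.HoldsAt, FirstOrder.Language.Term.realize_constants] at this ⊢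
    exact (key p).2 this)
  simp only [Equation.HoldsAt, oneQuasiIdentity,
    FirstOrder.Language.Term.realize_constants] at this ⊢
  exact (key t).1 this

/-- In the free algebra on x, y let `φ` be the least `K`-congruence identifying x and y, `N` its
kernel, and `ε` the endomorphism fixing x and sending y to 1. It suffices to find `n ∈ N` with `ε n
= x`: a term representing `n` is subtractive. -/
theorem RelativelyIdealDetermined.exists_isSubtractiveTerm [L.IsAlgebraic] {c : L.Constants}
    {K : AlgClass.{u, v, max u w} L} (hK : IsQuasivariety K) (hreg : RelativelyRegular c K)
    (h : RelativelyIdealDetermined c K) : ∃ s : L.Term (Fin 2), IsSubtractiveTerm c K s := by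
  obtain ⟨Γ, hΓ⟩ := hK
  replace hΓ : AxiomatizedBy K Γ := hΓ
  obtain ⟨F, hF, g, hgen, hfree⟩ := hΓ.exists_free (ULift.{max u w} (Fin 2))
  let φ : Congruence L F := Congruence.ofHoms K fun _ k => k (g ⟨0⟩) = k (g ⟨1⟩)
  have hφ : φ.IsRelative K := hΓ.isRelative_ofHoms _
  obtain ⟨ε, hε⟩ := hfree F hF fun i => ![g ⟨0⟩, (c : F)] i.down
  have hε0 : ε (g ⟨0⟩) = g ⟨0⟩ := hε ⟨0⟩
  have hε1 : ε (g ⟨1⟩) = (c : F) := hε ⟨1⟩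
  have hN := isIdeal_kernel (c := c) hF φ
  have hcN : (c : F) ∈ φ.kernel c := φ.refl _
  -- The saturation of `N` under `ε`: each `b j` may be replaced by an element of `N` with the same
  -- image, leaving `a` unchanged.
  have hJ : IsIdeal c K {a : F | ∃ n ∈ φ.kernel c, ε a = ε n} := by
    refine ⟨⟨c, c, hcN, rfl⟩, fun m k t ht a b hb => ?_⟩
    choose n hn hbn using hb
    refine ⟨_, hN.2 m k t ht a n hn, ?_⟩
    rw [← realize_hom, ← realize_hom]
    congr 1
    funext i
    rcases i with i | i
    · rfl
    · exact hbn i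
  obtain ⟨θ, ⟨hθ, hθJ⟩, -⟩ := h F hF _ hJ
  -- Since `N ⊆ J`, both sides have kernel `N`; regularity turns this inclusion of kernels into `φ ≤
  -- θ`.
  have hle : φ.inter θ = φ := by
    refine hreg F hF _ _ (hΓ.isRelative_inter hφ hθ) hφ (Set.ext fun a => ?_)
    refine ⟨fun ha => ha.1, fun ha => ⟨ha, ?_⟩⟩
    have : a ∈ θ.kernel c := hθJ ▸ ⟨a, ha, rfl⟩
    exact this
  have hxy : φ.r (g ⟨0⟩) (g ⟨1⟩) := fun B _ k hk => hk
  have hxy' : θ.r (g ⟨0⟩) (g ⟨1⟩) := by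
    rw [← hle] at hxy
    exact hxy.2
  have hy : g ⟨1⟩ ∈ θ.kernel c := by
    rw [hθJ]
    exact ⟨c, hcN, by rw [hε1, Hom.map_constants]⟩
  have hx : g ⟨0⟩ ∈ θ.kernel c := θ.trans hxy' hy
  rw [hθJ] at hx
  obtain ⟨n, hn, hxn⟩ := hx
  obtain ⟨t, rfl⟩ := hgen n
  refine ⟨t.relabel ULift.down, fun A hA a => ⟨?_, ?_⟩⟩
  · obtain ⟨k, hk⟩ := hfree A hA fun _ => a
    have := hn A hA k ((hk _).trans (hk _).symm)
    rw [← realize_hom, Hom.map_constants] at this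
    rw [FirstOrder.Language.Term.realize_relabel, ← this]
    congr 1
    funext i
    rw [hk]
    rcases i with ⟨i⟩
    fin_cases i <;> rfl
  · obtain ⟨k, hk⟩ := hfree A hA fun _ => a
    have := congrArg k hxn
    rw [hε0, hk, ← realize_hom, ← realize_hom] at this
    rw [FirstOrder.Language.Term.realize_relabel]
    refine Eq.trans ?_ this.symm
    congr 1
    funext i
    rcases i with ⟨i⟩
    fin_cases i
    · exact ((congrArg k hε0).trans (hk _)).symm
    · exact ((congrArg k hε1).trans (Hom.map_constants k c)).symm

end IdealDetermined

/-! ### Finite entailment and difference terms -/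

section Entailment

variable {L : FirstOrder.Language.{u, v}}

theorem realize_congr_varFinset {X A : Type*} [DecidableEq X] [L.Structure A] {x y : X → A}
    (t : L.Term X) (h : ∀ i ∈ t.varFinset, x i = y i) : t.realize x = t.realize y := by
  induction t with
  | var i => exact h i (by simp [FirstOrder.Language.Term.varFinset])
  | func f ts ih =>
    refine congrArg (funMap f) (funext fun j => ih j fun i hi => h i ?_)
    simp only [FirstOrder.Language.Term.varFinset, Finset.mem_biUnion]
    exact ⟨j, Finset.mem_univ j, hi⟩

/-- `K` satisfies the implication from `s ≈ 1` for all `s ∈ S` to `p ≈ q`. -/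
def Entails (c : L.Constants) (K : AlgClass.{u, v, w} L) {X : Type*} (S : Set (L.Term X))
    (p q : L.Term X) : Prop :=
  ∀ B ∈ K, ∀ x : X → B, (∀ s ∈ S, s.realize x = (c : B)) → p.realize x = q.realize x

/-- `p ≈ q` follows from finitely many of the equations `s ≈ 1`, `s ∈ M`. -/
def FinEntails (c : L.Constants) (K : AlgClass.{u, v, w} L) {X : Type*} (M : Set (L.Term X))
    (p q : L.Term X) : Prop :=
  ∃ S ⊆ M, S.Finite ∧ Entails c K S p q

theorem FinEntails.exists_common {c : L.Constants} {K : AlgClass.{u, v, w} L} {X : Type*}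
    {M : Set (L.Term X)} {ι : Type*} {T : Set ι} (hT : T.Finite) {p q : ι → L.Term X}
    (h : ∀ i ∈ T, FinEntails c K M (p i) (q i)) :
    ∃ S ⊆ M, S.Finite ∧ ∀ i ∈ T, Entails c K S (p i) (q i) := by
  choose! S hSM hS hE using h
  refine ⟨⋃ i ∈ T, S i, Set.iUnion₂_subset hSM, hT.biUnion hS, fun i hi B hB x hx => ?_⟩
  exact hE i hi B hB x fun s hs => hx s (Set.mem_biUnion hi hs)

/-- The relation on an algebra that finite entailment between terms induces by evaluation. -/
def entailRel (c : L.Constants) (K : AlgClass.{u, v, w} L) {X A : Type*} [L.Structure A]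
    (M : Set (L.Term X)) (x : X → A) (a b : A) : Prop :=
  ∃ p q : L.Term X, p.realize x = a ∧ q.realize x = b ∧ FinEntails c K M p q

/-- By `hx`, the choice of terms representing the two elements is immaterial: changing them costs
finitely many further premises. -/
theorem entailRel_realize_iff {c : L.Constants} {K : AlgClass.{u, v, w} L} {X A : Type*}
    [L.Structure A] {M : Set (L.Term X)} {x : X → A}
    (hx : ∀ p q : L.Term X, p.realize x = q.realize x → FinEntails c K M p q)
    {p q : L.Term X} :
    entailRel c K M x (p.realize x) (q.realize x) ↔ FinEntails c K M p q := by
  refine ⟨?_, fun h => ⟨p, q, rfl, rfl, h⟩⟩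
  rintro ⟨p', q', hp, hq, S, hSM, hS, hE⟩
  obtain ⟨S₁, h₁M, h₁, hE₁⟩ := hx _ _ hp
  obtain ⟨S₂, h₂M, h₂, hE₂⟩ := hx _ _ hq
  refine ⟨S ∪ (S₁ ∪ S₂), Set.union_subset hSM (Set.union_subset h₁M h₂M),
    hS.union (h₁.union h₂), fun B hB y hy => ?_⟩
  rw [← hE₁ B hB y fun s hs => hy s (Or.inr (Or.inl hs)),
    ← hE₂ B hB y fun s hs => hy s (Or.inr (Or.inr hs))]
  exact hE B hB y fun s hs => hy s (Or.inl hs)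

/-- The relation induced by finite entailment, as a congruence. -/
def entailCongruence (c : L.Constants) (K : AlgClass.{u, v, w} L) {X A : Type*}
    [L.Structure A] (M : Set (L.Term X)) (x : X → A)
    (hx : ∀ p q : L.Term X, p.realize x = q.realize x → FinEntails c K M p q)
    (hsurj : ∀ a : A, ∃ t : L.Term X, t.realize x = a) : Congruence L A where
  r := entailRel c K M x
  iseqv := by
    refine ⟨fun a => ?_, ?_, ?_⟩
    · obtain ⟨t, rfl⟩ := hsurj a
      exact ⟨t, t, rfl, rfl, hx _ _ rfl⟩
    · rintro _ _ ⟨p, q, hp, hq, S, hSM, hS, hE⟩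
      exact ⟨q, p, hq, hp, S, hSM, hS, fun B hB y hy => (hE B hB y hy).symm⟩
    · rintro _ _ d ⟨p, q, hp, rfl, S, hSM, hS, hE⟩ h
      obtain ⟨t, rfl⟩ := hsurj d
      obtain ⟨S', hSM', hS', hE'⟩ := (entailRel_realize_iff hx).1 h
      exact ⟨p, t, hp, rfl, S ∪ S', Set.union_subset hSM hSM', hS.union hS', fun B hB y hy =>
        (hE B hB y fun s hs => hy s (Or.inl hs)).trans
          (hE' B hB y fun s hs => hy s (Or.inr hs))⟩
  compat f a b h := by
    choose p q hp hq hE using h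
    obtain rfl : (fun i => (p i).realize x) = a := funext hp
    obtain rfl : (fun i => (q i).realize x) = b := funext hq
    obtain ⟨S, hSM, hS, hE⟩ := FinEntails.exists_common Set.finite_univ fun i _ => hE i
    exact ⟨.func f p, .func f q, rfl, rfl, S, hSM, hS, fun B hB y hy =>
      congrArg (funMap f) (funext fun i => hE i trivial B hB y hy)⟩

/-- A quasi-identity has finitely many premises, so the finite sets witnessing them combine into one
finite set witnessing the conclusion. -/
theorem AxiomatizedBy.isRelative_entailCongruence [L.IsAlgebraic] {c : L.Constants}
    {K : AlgClass.{u, v, w} L} {Γ : Set (QuasiIdentity L)} (hΓ : AxiomatizedBy K Γ)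
    {X : Type*} {A : Type w} [L.Structure A] (M : Set (L.Term X)) (x : X → A)
    (hx : ∀ p q : L.Term X, p.realize x = q.realize x → FinEntails c K M p q)
    (hsurj : ∀ a : A, ∃ t : L.Term X, t.realize x = a) :
    (entailCongruence c K M x hx hsurj).IsRelative K := by
  rw [hΓ.isRelative_iff]
  intro q hq y hy
  choose z hz using fun i => hsurj (y i)
  obtain rfl : (fun i => (z i).realize x) = y := funext hz
  have key (p p' : L.Term ℕ) :
      (entailCongruence c K M x hx hsurj).r (p.realize fun i => (z i).realize x)
        (p'.realize fun i => (z i).realize x) ↔ FinEntails c K M (p.subst z) (p'.subst z) := by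
    rw [← entailRel_realize_iff hx, FirstOrder.Language.Term.realize_subst,
      FirstOrder.Language.Term.realize_subst]
    rfl
  simp only [key] at hy ⊢
  obtain ⟨S, hSM, hS, hE⟩ :=
    FinEntails.exists_common (T := {e | e ∈ q.premises}) q.premises.finite_toSet hy
  refine ⟨S, hSM, hS, fun B hB b hb => ?_⟩
  have := (hΓ B).1 hB q hq (fun i => (z i).realize b) fun e he => by
    have := hE e he B hB b hb
    rwa [FirstOrder.Language.Term.realize_subst, FirstOrder.Language.Term.realize_subst] at this
  rwa [FirstOrder.Language.Term.realize_subst, FirstOrder.Language.Term.realize_subst]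

/-- A relatively regular quasivariety has finitely many terms `d(x,y)` such that `x ≈ y` is
equivalent to the conjunction of the equations `d(x,y) ≈ 1`. -/
theorem RelativelyRegular.exists_differenceTerms [L.IsAlgebraic] {c : L.Constants}
    {K : AlgClass.{u, v, max u w} L} (hK : IsQuasivariety K) (hreg : RelativelyRegular c K) :
    ∃ D : Set (L.Term (Fin 2)), D.Finite ∧
      (∀ d ∈ D, ∀ A ∈ K, ∀ a : A, d.realize ![a, a] = (c : A)) ∧
      ∀ A ∈ K, ∀ a b : A, (∀ d ∈ D, d.realize ![a, b] = (c : A)) → a = b := by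
  obtain ⟨Γ, hΓ⟩ := hK
  replace hΓ : AxiomatizedBy K Γ := hΓ
  obtain ⟨F, hF, g, hgen, hfree⟩ := hΓ.exists_free (ULift.{max u w} (Fin 2))
  let φ : Congruence L F := Congruence.ofHoms K fun _ k => k (g ⟨0⟩) = k (g ⟨1⟩)
  have hφ : φ.IsRelative K := hΓ.isRelative_ofHoms _
  let M : Set (L.Term (ULift.{max u w} (Fin 2))) := {t | t.realize g ∈ φ.kernel c}
  have hM {t : L.Term (ULift.{max u w} (Fin 2))} (ht : t ∈ M)
      {B : Bundled.{max u w} L.Structure} (hB : B ∈ K) (k : F →[L] B)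
      (hk : k (g ⟨0⟩) = k (g ⟨1⟩)) : t.realize (fun i => k (g i)) = (c : B) := by
    have := ht B hB k hk
    rwa [Hom.map_constants, ← realize_hom] at this
  have hx (p q : L.Term (ULift.{max u w} (Fin 2))) (h : p.realize g = q.realize g) :
      FinEntails c K M p q := by
    refine ⟨∅, Set.empty_subset _, Set.finite_empty, fun B hB y _ => ?_⟩
    obtain ⟨k, hk⟩ := hfree B hB y
    obtain rfl : (fun i => k (g i)) = y := funext hk
    rw [realize_hom, realize_hom, h]
  let θ := entailCongruence c K M g hx hgen
  have hθ : θ.IsRelative K := hΓ.isRelative_entailCongruence M g hx hgen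
  have hcg : (FirstOrder.Language.Constants.term c).realize g = (c : F) :=
    FirstOrder.Language.Term.realize_constants
  -- Both kernels consist of the values of the terms in `M`. Regularity then makes x ≈ y a
  -- consequence of finitely many equations `t ≈ 1` with `t ∈ M`; these `t` are the difference
  -- terms.
  have heq : θ = φ := by
    refine hreg F hF _ _ hθ hφ (Set.ext fun a => ⟨?_, fun ha => ?_⟩)
    · rintro ⟨p, q, rfl, hq, S, hSM, hS, hE⟩ B hB k hk
      rw [← hq, ← realize_hom, ← realize_hom]
      exact hE B hB _ fun s hs => hM (hSM hs) hB k hk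
    · obtain ⟨t, rfl⟩ := hgen a
      refine ⟨t, c.term, rfl, hcg, {t}, Set.singleton_subset_iff.2 ha, Set.finite_singleton t,
        fun B hB y hy => ?_⟩
      rw [hy t rfl, FirstOrder.Language.Term.realize_constants]
  have hxy : φ.r (g ⟨0⟩) (g ⟨1⟩) := fun B _ k hk => hk
  rw [← heq] at hxy
  obtain ⟨S, hSM, hS, hE⟩ :=
    (entailRel_realize_iff (p := .var ⟨0⟩) (q := .var ⟨1⟩) hx).1 hxy
  have hrel {A : Bundled.{max u w} L.Structure} (t : L.Term (ULift.{max u w} (Fin 2)))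
      (a b : A) : (t.relabel ULift.down).realize ![a, b] =
        t.realize (fun i => ![a, b] i.down) := by
    rw [FirstOrder.Language.Term.realize_relabel]
    rfl
  refine ⟨(fun t => t.relabel ULift.down) '' S, hS.image _, ?_, fun A hA a b h => ?_⟩
  · rintro _ ⟨t, ht, rfl⟩ A hA a
    obtain ⟨k, hk⟩ := hfree A hA fun i => ![a, a] i.down
    rw [hrel, ← hM (hSM ht) hA k (by rw [hk, hk]; rfl)]
    simp only [hk]
  · exact hE A hA (fun i => ![a, b] i.down) fun s hs => by
      rw [← hrel]
      exact h _ ⟨s, hs, rfl⟩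

theorem OneConservative.realize_eq {c : L.Constants} {K : AlgClass.{u, v, w} L}
    (h : OneConservative c K) {X : Type*} {S : Set (L.Term X)} (hS : S.Finite)
    {t : L.Term X} (hE : Entails c K S t c.term) {B : Bundled.{w} L.Structure}
    (hB : B ∈ HSP K) (x : X → B) (hx : ∀ s ∈ S, s.realize x = (c : B)) :
    t.realize x = (c : B) := by
  classical
  -- Only finitely many variables occur; they are renamed injectively into `ℕ`, and the other
  -- indices receive the harmless value 1.
  let V : Set X := ⋃ s ∈ insert t S, (s.varFinset : Set X)
  have hV : V.Finite := (hS.insert t).biUnion fun s _ => s.varFinset.finite_toSet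
  obtain ⟨e, he⟩ := Set.countable_iff_exists_injOn.1 hV.countable
  obtain ⟨y, hy⟩ : ∃ y : ℕ → B, ∀ i ∈ V, y (e i) = x i := by
    refine ⟨fun n => if hn : ∃ i ∈ V, e i = n then x hn.choose else c, fun i hi => ?_⟩
    have hn : ∃ j ∈ V, e j = e i := ⟨i, hi, rfl⟩
    simp only [dif_pos hn]
    exact congrArg x (he hn.choose_spec.1 hi hn.choose_spec.2)
  have key (s : L.Term X) (hs : s ∈ insert t S) :
      (s.relabel e).realize y = s.realize x := by
    rw [FirstOrder.Language.Term.realize_relabel]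
    exact realize_congr_varFinset s fun i hi => hy i (Set.mem_biUnion hs hi)
  have hsat : K.Satisfies
      (oneQuasiIdentity c (hS.toFinset.toList.map fun s => s.relabel e) (t.relabel e)) := by
    intro A hA z hz
    have := hE A hA (z ∘ e) fun s hs => by
      have := hz ⟨s.relabel e, c.term⟩ (by
        simp only [oneQuasiIdentity, List.map_map, List.mem_map]
        exact ⟨s, by simpa using hs, rfl⟩)
      simpa [Equation.HoldsAt] using this
    simpa [Equation.HoldsAt, oneQuasiIdentity] using this
  have := (h _ _).1 hsat B hB y (by
    intro q hq
    simp only [oneQuasiIdentity, List.map_map, List.mem_map] at hq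
    obtain ⟨s, hs, rfl⟩ := hq
    have hs : s ∈ S := by simpa using hs
    simp only [Equation.HoldsAt, Function.comp, FirstOrder.Language.Term.realize_constants]
    rw [key s (Or.inr hs), hx s hs])
  simp only [Equation.HoldsAt, oneQuasiIdentity,
    FirstOrder.Language.Term.realize_constants] at this
  rwa [key t (Or.inl rfl)] at this

end Entailment

/-! ### Ideals as kernels in the presence of a subtractive term -/

section Subtractive

variable {L : FirstOrder.Language.{u, v}}

/-- The relation identifying elements that no unary polynomial separates with respect to `I`. -/
def polyRel (L : FirstOrder.Language.{u, v}) {A : Type*} [L.Structure A] (I : Set A)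
    (a b : A) : Prop :=
  ∀ (m : ℕ) (p : L.Term (Fin m ⊕ Fin 1)) (z : Fin m → A),
    p.realize (Sum.elim z fun _ => a) ∈ I ↔ p.realize (Sum.elim z fun _ => b) ∈ I

theorem polyRel.funMap_update {A : Type*} [L.Structure A] {I : Set A} {a b : A}
    (h : polyRel L I a b) {n : ℕ} (f : L.Functions n) (z : Fin n → A) (j : Fin n) :
    polyRel L I (funMap f (Function.update z j a)) (funMap f (Function.update z j b)) := by
  intro m p y
  let t : L.Term (Fin (m + n) ⊕ Fin 1) := p.subst (Sum.elim
    (fun i => .var (Sum.inl (Fin.castAdd n i)))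
    fun _ => .func f fun i => if i = j then .var (Sum.inr 0) else .var (Sum.inl (Fin.natAdd m i)))
  have key (d : A) : t.realize (Sum.elim (Fin.append y z) fun _ => d) =
      p.realize (Sum.elim y fun _ => funMap f (Function.update z j d)) := by
    rw [FirstOrder.Language.Term.realize_subst]
    congr 1
    funext i
    rcases i with i | i
    · simp
    · simp only [Sum.elim_inr, FirstOrder.Language.Term.realize_func]
      congr 1
      funext i
      by_cases hi : i = j <;> simp [hi]
  rw [← key, ← key]
  exact h _ t _

/-- The largest congruence of which a given set is a union of classes. -/
def polyCongruence (L : FirstOrder.Language.{u, v}) {A : Type*} [L.Structure A]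
    (I : Set A) : Congruence L A where
  r := polyRel L I
  iseqv := ⟨fun _ _ _ _ => Iff.rfl, fun h m p z => (h m p z).symm,
    fun h h' m p z => (h m p z).trans (h' m p z)⟩
  compat {n} f x y h := by
    -- Arguments are changed one at a time; `S` records those already changed.
    suffices H : ∀ S : Finset (Fin n), polyRel L I (funMap f x) (funMap f (S.piecewise y x)) by
      have := H Finset.univ
      rwa [Finset.piecewise_univ] at this
    intro S
    induction S using Finset.induction_on with
    | empty =>
      rw [Finset.piecewise_empty]
      exact fun _ _ _ => Iff.rfl
    | insert j S hj ih =>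
      rw [Finset.piecewise_insert]
      intro m p z
      refine (ih m p z).trans ?_
      have := (h j).funMap_update f (S.piecewise y x) j m p z
      rwa [show x j = S.piecewise y x j from (Finset.piecewise_eq_of_notMem S y x hj).symm,
        Function.update_eq_self] at this

/-- In a class with a subtractive term, every ideal is the kernel of a congruence. -/
theorem IsSubtractiveTerm.kernel_polyCongruence {c : L.Constants} {K : AlgClass.{u, v, w} L}
    {s : L.Term (Fin 2)} (hs : IsSubtractiveTerm c K s) {A : Bundled.{w} L.Structure}
    (hA : A ∈ K) {I : Set A} (hI : IsIdeal c K I) : (polyCongruence L I).kernel c = I := by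
  have hsub {X : Type} {B : Type w} [L.Structure B] (p q : L.Term X) (y : X → B) :
      (s.subst ![p, q]).realize y = s.realize ![p.realize y, q.realize y] := by
    rw [FirstOrder.Language.Term.realize_subst]
    congr 1
    funext i
    fin_cases i <;> rfl
  have hone : (c : A) ∈ I := by
    obtain ⟨b, hb⟩ := hI.1
    have := hI.2 0 1 c.term (fun B _ a => FirstOrder.Language.Term.realize_constants) ![]
      (fun _ => b) fun _ => hb
    rwa [FirstOrder.Language.Term.realize_constants] at this
  -- The term s(x, s(s(x, y₀), y₁)) is an ideal term in y₀, y₁. At x = z, y₀ = y, y₁ = s(z, y) its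
  -- value is s(z, 1) = z.
  have hcancel {z y : A} (hy : y ∈ I) (hzy : s.realize ![z, y] ∈ I) : z ∈ I := by
    let x₀ : L.Term (Fin 1 ⊕ Fin 2) := .var (Sum.inl 0)
    let t : L.Term (Fin 1 ⊕ Fin 2) :=
      s.subst ![x₀, s.subst ![s.subst ![x₀, .var (Sum.inr 0)], .var (Sum.inr 1)] ]
    have := hI.2 1 2 t (fun B hB a => by
      simp only [t, x₀, hsub, FirstOrder.Language.Term.realize_var, Sum.elim_inl, Sum.elim_inr,
        (hs B hB _).2, (hs B hB _).1]) ![z] ![y, s.realize ![z, y] ] (by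
      intro j
      fin_cases j
      · exact hy
      · exact hzy)
    simpa [t, x₀, hsub, (hs A hA _).1, (hs A hA _).2] using this
  -- By s(x, x) = 1, the differences of p(z, y) and p(z, 1), in either order, are ideal terms in y.
  have hdiff {m : ℕ} (p : L.Term (Fin m ⊕ Fin 1)) (z : Fin m → A) {b : A} (hb : b ∈ I) :
      s.realize ![p.realize (Sum.elim z fun _ => b), p.realize (Sum.elim z fun _ => (c : A))] ∈ I ∧
      s.realize ![p.realize (Sum.elim z fun _ => (c : A)), p.realize (Sum.elim z fun _ => b)] ∈
        I := by
    let p₁ : L.Term (Fin m ⊕ Fin 1) :=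
      p.subst (Sum.elim (fun i => .var (Sum.inl i)) fun _ => c.term)
    have hp₁ {B : Bundled.{w} L.Structure} (y : Fin m ⊕ Fin 1 → B) :
        p₁.realize y = p.realize (Sum.elim (fun i => y (Sum.inl i)) fun _ => (c : B)) := by
      rw [FirstOrder.Language.Term.realize_subst]
      congr 1
      funext i
      rcases i with i | i <;> simp
    constructor
    · have := hI.2 m 1 (s.subst ![p, p₁]) (fun B hB a => by
        rw [hsub, hp₁]
        exact (hs B hB _).1) z (fun _ => b) fun _ => hb
      rwa [hsub, hp₁] at this
    · have := hI.2 m 1 (s.subst ![p₁, p]) (fun B hB a => by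
        rw [hsub, hp₁]
        exact (hs B hB _).1) z (fun _ => b) fun _ => hb
      rwa [hsub, hp₁] at this
  refine Set.ext fun b => ⟨fun h => ?_, fun hb m p z => ?_⟩
  · exact (h 0 (.var (Sum.inr 0)) ![]).2 hone
  · exact ⟨fun h => hcancel h (hdiff p z hb).2, fun h => hcancel h (hdiff p z hb).1⟩

theorem relativelyIdealDetermined_of_subtractive [L.IsAlgebraic] {c : L.Constants}
    {K : AlgClass.{u, v, max u w} L} (hK : IsQuasivariety K) (hreg : RelativelyRegular c K)
    (hcons : OneConservative c K) {s : L.Term (Fin 2)} (hs : IsSubtractiveTerm c K s) :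
    RelativelyIdealDetermined c K := by
  intro A hA I hI
  obtain ⟨D, hD, hD1, hD2⟩ := hreg.exists_differenceTerms hK
  obtain ⟨Γ, hΓ⟩ := hK
  replace hΓ : AxiomatizedBy K Γ := hΓ
  let φ := polyCongruence L I
  have hφ : φ.kernel c = I := hs.kernel_polyCongruence hA hI
  have hone : (c : A) ∈ I := hφ ▸ φ.refl _
  have hsub {B : Bundled.{max u w} L.Structure} (d : L.Term (Fin 2)) (p q : L.Term A)
      (y : A → B) : (d.subst ![p, q]).realize y = d.realize ![p.realize y, q.realize y] := by
    rw [FirstOrder.Language.Term.realize_subst]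
    congr 1
    funext i
    fin_cases i <;> rfl
  -- The elements of `A` serve as variables, evaluated by the identity.
  let M : Set (L.Term A) := {t | t.realize id ∈ I}
  have hx (p q : L.Term A) (h : p.realize id = q.realize id) : FinEntails c K M p q := by
    refine ⟨(fun d => d.subst ![p, q]) '' D, ?_, hD.image _, fun B hB y hy => ?_⟩
    · rintro _ ⟨d, hd, rfl⟩
      change (d.subst ![p, q]).realize id ∈ I
      rw [hsub, h, hD1 d hd A hA]
      exact hone
    · refine hD2 B hB _ _ fun d hd => ?_
      rw [← hsub]
      exact hy _ ⟨d, hd, rfl⟩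
  have hsurj (a : A) : ∃ t : L.Term A, t.realize id = a := ⟨.var a, rfl⟩
  have hc : (FirstOrder.Language.Constants.term c).realize id = (c : A) :=
    FirstOrder.Language.Term.realize_constants
  let θ := entailCongruence c K M id hx hsurj
  have hθ : θ.IsRelative K := hΓ.isRelative_entailCongruence M id hx hsurj
  have hθI : θ.kernel c = I := by
    refine Set.ext fun a => ⟨fun ha => ?_, fun ha => ?_⟩
    · change entailRel c K M id a c at ha
      rw [← hc] at ha
      obtain ⟨S, hSM, hS, hE⟩ := (entailRel_realize_iff (p := .var a) hx).1 ha
      have hr (t : L.Term A) : t.realize (fun i => φ.proj i) = φ.proj (t.realize id) :=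
        realize_hom φ.proj t id
      -- The premises hold in `A/φ` because they take values in `I`, the kernel of `φ`;
      -- conservativity gives the conclusion there, so `a ∈ I`.
      have := hcons.realize_eq hS hE (mem_HSP_of_surjective hA φ.proj φ.proj_surjective)
        (fun i => φ.proj i) fun s hs => by
          rw [hr, ← φ.mem_kernel_iff, hφ]
          exact hSM hs
      rw [hr, ← φ.mem_kernel_iff, hφ] at this
      exact this
    · refine ⟨.var a, c.term, rfl, hc, {.var a}, Set.singleton_subset_iff.2 ha,
        Set.finite_singleton _, fun B hB y hy => ?_⟩
      rw [hy _ rfl, FirstOrder.Language.Term.realize_constants]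
  exact ⟨θ, ⟨hθ, hθI⟩, fun ψ hψ => hreg A hA _ _ hψ.1 hθ (hψ.2.trans hθI.symm)⟩

end Subtractive

end UnivAlg

/-- The algebras live in a universe that is at least as large as that of the operation symbols, so
that free algebras are available; `w` may be `0`. -/
theorem mainTheorem7 {L : FirstOrder.Language.{u, v}} [L.IsAlgebraic] (c : L.Constants)
    (Q : UnivAlg.AlgClass.{u, v, max u w} L) (hQ : UnivAlg.IsQuasivariety Q)
    (hreg : UnivAlg.RelativelyRegular c Q) :
    UnivAlg.RelativelyIdealDetermined c Q ↔
      UnivAlg.OneConservative c Q ∧ ∃ s : L.Term (Fin 2), UnivAlg.IsSubtractiveTerm c Q s := by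
  constructor
  · exact fun h => ⟨h.oneConservative hQ, h.exists_isSubtractiveTerm.{u, v, w} hQ hreg⟩
  · rintro ⟨hcons, s, hs⟩
    exact UnivAlg.relativelyIdealDetermined_of_subtractive.{u, v, w} hQ hreg hcons hs
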